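/- **Setting.** In a $K$-armed Gaussian bandit, a pull of arm $a\in[K]$ gives a reward with law $\mathcal N(\mu_a,\sigma_a^2)$, $\sigma_a>0$. Put $\mu^\star=\max_a\mu_a$ and $\Delta_a=\mu^\star-\mu_a$. *Stable Thompson Sampling* with tuning parameter $\gamma>0$ pulls each arm once in the first $K$ rounds. In every round $t>K$ it draws, independently given the past, $\theta_{a,t}\sim\mathcal N(\widehat\mu_{a,t-1},\gamma/n_{a,t-1})$ for each arm $a$, and pulls $A_t\in\arg\max_a\theta_{a,t}$. It then receives $X_t$, which has law $\mathcal N(\mu_{A_t},\sigma_{A_t}^2)$ given the past and $A_t$. Here $n_{a,t}$ is the number of pulls of arm $a$ in the first $t$ rounds, and $\widehat\mu_{a,t}$ is the average of the rewards obtained from these pulls. The expected regret is $\mathcal R(T)=T\mu^\star-\mathbb E\big[\sum_{t=1}^T X_t\big]$. **Proposition.** There are universal constants $\kappa_1,\kappa_2,\kappa_3>0$ such that for every $K$-armed Gaussian bandit the following holds. (i) Let $T\ge K$ and let $\gamma$ be such that $\gamma\ge 4\sigma_a^2$ and $\Delta_a^2\le\gamma\log T$ for all arms $a$. Then, for Stable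 Thompson Sampling with tuning parameter $\gamma_T=\gamma$, every arm $j$ with $\Delta_j>0$ satisfies $$\mathbb E[n_{j,T}]\le \kappa_1\frac{\gamma_T}{\Delta_j^2}\log\Big(\frac{T\Delta_j^2}{\gamma_T}+\kappa_2\Big)+\kappa_3\frac{\gamma_T}{\Delta_j^2},$$ the expectation $\mathbb E\big[\sum_{t=1}^T X_t\big]$ exists, and $$\mathcal R(T)\le\sum_{j:\Delta_j>0}\Big[\kappa_1\frac{\gamma_T}{\Delta_j}\log\Big(\frac{T\Delta_j^2}{\gamma_T}+\kappa_2\Big)+\kappa_3\frac{\gamma_T}{\Delta_j}\Big].$$ (ii) Consequently, for every sequence $(\gamma_T)$ with $\gamma_T/\log\log T\to\infty$ and $\sqrt{\log T}/\gamma_T\to\infty$ as $T\to\infty$, the same three conclusions hold for all sufficiently large $T$ when Stable Thompson Sampling is run with tuning parameter $\gamma_T$. -/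

import Mathlib

open MeasureTheory ProbabilityTheory Filter Topology

universe u

noncomputable section

/-- `n_{a,t}`: the number of the first `t` rounds in which arm `a` is pulled, when `A s` is the
arm pulled in round `s + 1`. -/
def pullCount {K : ℕ} {Ω : Type*} (A : ℕ → Ω → Fin K) (a : Fin K) (t : ℕ) (ω : Ω) : ℕ :=
  ((Finset.range t).filter (fun s => A s ω = a)).card

/-- `μ̂_{a,t}`: the average of the rewards that arm `a` produced in the first `t` rounds, when
`X s` is the reward received in round `s + 1`. -/
def sampleMean {K : ℕ} {Ω : Type*} (A : ℕ → Ω → Fin K) (X : ℕ → Ω → ℝ)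
    (a : Fin K) (t : ℕ) (ω : Ω) : ℝ :=
  (∑ s ∈ (Finset.range t).filter (fun s => A s ω = a), X s ω) / (pullCount A a t ω : ℝ)

/-- The gap `Δ_a = μ⋆ - μ_a` of arm `a`, where `μ⋆` is the largest arm mean. -/
def gap {K : ℕ} (μ : Fin K → ℝ) (a : Fin K) : ℝ :=
  (⨆ b, μ b) - μ a

/-- A run of Stable Thompson Sampling with tuning parameter `γ` on the `K`-armed Gaussian bandit
whose arm `a` has reward distribution `N(μ a, (σ a)²)`, on the probability space `(Ω, P)`.

Rounds are numbered from `0`: `A t`, `X t`, `Z a t`, `ξ t` belong to round `t + 1`.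
The variables `Z a t`, `ξ t` are independent standard Gaussians. Given the past, the posterior
samples `μ̂_{a,t} + √(γ / n_{a,t}) Z a t` are therefore independent with laws
`N(μ̂_{a,t}, γ / n_{a,t})`, and, given the past and the arm pulled, the reward has law
`N(μ (A t), (σ (A t))²)`. -/
structure StableTSRun {K : ℕ} {Ω : Type*} [MeasurableSpace Ω] (P : Measure Ω)
    (μ σ : Fin K → ℝ) (γ : ℝ) where
  /-- the arm pulled -/
  A : ℕ → Ω → Fin K
  /-- the reward received -/
  X : ℕ → Ω → ℝ
  /-- the standardized posterior samples -/
  Z : Fin K → ℕ → Ω → ℝ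
  /-- the standardized reward noise -/
  ξ : ℕ → Ω → ℝ
  /-- the rule that picks a maximizing index; how it breaks ties is left open -/
  argmax : (Fin K → ℝ) → Fin K
  measurable_argmax : Measurable argmax
  le_argmax : ∀ (θ : Fin K → ℝ) (a : Fin K), θ a ≤ θ (argmax θ)
  measurable_Z : ∀ a t, Measurable (Z a t)
  measurable_ξ : ∀ t, Measurable (ξ t)
  law_Z : ∀ a t, P.map (Z a t) = gaussianReal 0 1
  law_ξ : ∀ t, P.map (ξ t) = gaussianReal 0 1
  indep : iIndepFun (Sum.elim (fun p : Fin K × ℕ => Z p.1 p.2) ξ) P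
  /-- each arm is pulled once in the first `K` rounds -/
  arm_init : ∀ t ω, t < K → (A t ω : ℕ) = t
  /-- afterwards the arm with the largest posterior sample is pulled -/
  arm_step : ∀ t ω, K ≤ t →
    A t ω = argmax (fun a =>
      sampleMean A X a t ω + √(γ / (pullCount A a t ω : ℝ)) * Z a t ω)
  reward : ∀ t ω, X t ω = μ (A t ω) + σ (A t ω) * ξ t ω

/-- The expected regret over `T` rounds, `T μ⋆ - E[X_1 + ⋯ + X_T]`. -/
def regret {K : ℕ} {Ω : Type*} [MeasurableSpace Ω] (P : Measure Ω)
    (μ : Fin K → ℝ) (X : ℕ → Ω → ℝ) (T : ℕ) : ℝ :=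
  (T : ℝ) * (⨆ b, μ b) - ∫ ω, ∑ t ∈ Finset.range T, X t ω ∂P

/-- The conclusion for one run and horizon `T`: the total reward has an expectation, the expected
number of pulls of each suboptimal arm obeys the per-arm bound, and the regret obeys the
regret bound, with the constants `κ₁, κ₂, κ₃`. -/
def RunBounds (κ₁ κ₂ κ₃ : ℝ) {K : ℕ} {Ω : Type*} [MeasurableSpace Ω] {P : Measure Ω}
    {μ σ : Fin K → ℝ} {γ : ℝ} (R : StableTSRun P μ σ γ) (T : ℕ) : Prop :=
  Integrable (fun ω => ∑ t ∈ Finset.range T, R.X t ω) P ∧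
  (∀ j, 0 < gap μ j →
    ∫ ω, (pullCount R.A j T ω : ℝ) ∂P ≤
      κ₁ * (γ / gap μ j ^ 2) * Real.log (T * gap μ j ^ 2 / γ + κ₂) + κ₃ * (γ / gap μ j ^ 2)) ∧
  regret P μ R.X T ≤
    ∑ j ∈ Finset.univ.filter (fun j => 0 < gap μ j),
      (κ₁ * (γ / gap μ j) * Real.log (T * gap μ j ^ 2 / γ + κ₂) + κ₃ * (γ / gap μ j))

end

open scoped ENNReal

/-! Fix a suboptimal arm `j`, a best arm `b`, the gap `D` and the midpoint `y = μ j + D/2 = μ b -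
D/2`. A pull of `j` falls under one of four headings (`ite_arm_eq_le`): fewer than `l` earlier
pulls, at most `l` times; a posterior Gaussian above `D/4 * √(l/γ)`, of probability at most
`exp(-D²l/(32γ))`; an empirical mean of `j` above `μ j + D/4`; or a posterior sample of `j` below
`y`.

In the last case every sample is below `y`. Given the samples of the arms other than `b`, this is
compared with the event that only `b` exceeds `y`, in which `b` is pulled (`measure_arm_sample_le`).
The price is the odds that the sample of `b` stays low, so the case is charged to pulls of `b`.
Since `4σ² ≤ γ`, these odds and the indicator of the third case are both at most a constant times
`exp(3S²/(8n) - D²n/(32γ))`, where `S` is the noise sum of the arm pulled and `n` its count.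

At the pull with `n = k`, `exp(3S²/(8k))` is a Gaussian mixture of stopped exponential martingales,
so its expectation is at most 2 (`sum_lintegral_exp_sq_le`). The geometric sum over `k` gives
`64γ/D²` with no logarithm. The logarithm comes only from `l`, about `32(γ/D²) log(TD²/γ + e)`,
chosen so that the second case costs at most `γ/D²`. The regret bound follows by weighting with the
gaps, and the asymptotic form because `γ T → ∞`. -/

/-! ### Gaussian tails and odds. -/

lemma lintegral_exp_mul_stdGaussian (l : ℝ) :
    ∫⁻ z, ENNReal.ofReal (Real.exp (l * z)) ∂(gaussianReal 0 1) =
      ENNReal.ofReal (Real.exp (l ^ 2 / 2)) := by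
  rw [← ofReal_integral_eq_lintegral_ofReal (integrable_exp_mul_gaussianReal l)
    (ae_of_all _ fun z => (Real.exp_pos _).le)]
  have h := congrFun (mgf_fun_id_gaussianReal (μ := 0) (v := 1)) l
  simp only [mgf, zero_mul, zero_add, NNReal.coe_one, one_mul] at h
  rw [h]

/-- The weight leaves the kernel `exp(-z²/8)`, of standard deviation 2. This is the total mass of
the mixture of exponential martingales used below. -/
lemma lintegral_exp_sq_stdGaussian :
    ∫⁻ z, ENNReal.ofReal (Real.exp (3 * z ^ 2 / 8)) ∂(gaussianReal 0 1) = 2 := by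
  rw [gaussianReal_of_var_ne_zero _ one_ne_zero,
    lintegral_withDensity_eq_lintegral_mul _ (measurable_gaussianPDF 0 1) (by fun_prop)]
  have h : ∀ z : ℝ, (gaussianPDF 0 1 * fun z => ENNReal.ofReal (Real.exp (3 * z ^ 2 / 8))) z =
      ENNReal.ofReal ((√(2 * Real.pi))⁻¹ * Real.exp (-(1 / 8) * z ^ 2)) := by
    intro z
    rw [Pi.mul_apply, gaussianPDF, ← ENNReal.ofReal_mul (gaussianPDFReal_nonneg _ _ _),
      gaussianPDFReal]
    simp only [NNReal.coe_one, mul_one, sub_zero]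
    rw [mul_assoc, ← Real.exp_add]
    congr 3
    ring
  simp_rw [h]
  rw [← ofReal_integral_eq_lintegral_ofReal
    ((integrable_exp_neg_mul_sq (by norm_num)).const_mul _)
    (ae_of_all _ fun z => by positivity), integral_const_mul, integral_gaussian,
    ← Real.sqrt_inv, ← Real.sqrt_mul (by positivity)]
  have : (2 * Real.pi)⁻¹ * (Real.pi / (1 / 8)) = 2 ^ 2 := by
    field_simp
    norm_num
  rw [this, Real.sqrt_sq (by norm_num)]
  norm_num

/-- Chernoff's bound with the optimal tilt `x`. -/
lemma stdGaussian_Ioi_le {x : ℝ} (hx : 0 ≤ x) :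
    gaussianReal 0 1 (Set.Ioi x) ≤ ENNReal.ofReal (Real.exp (-x ^ 2 / 2)) := by
  calc gaussianReal 0 1 (Set.Ioi x)
      = ∫⁻ z, (Set.Ioi x).indicator 1 z ∂(gaussianReal 0 1) :=
        (lintegral_indicator_one measurableSet_Ioi).symm
    _ ≤ ∫⁻ z, ENNReal.ofReal (Real.exp (-x ^ 2)) * ENNReal.ofReal (Real.exp (x * z))
          ∂(gaussianReal 0 1) := by
        refine lintegral_mono fun z => ?_
        by_cases hz : z ∈ Set.Ioi x
        · rw [Set.indicator_of_mem hz, Pi.one_apply, ← ENNReal.ofReal_mul (Real.exp_pos _).le,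
            ← Real.exp_add, ENNReal.one_le_ofReal, Real.one_le_exp_iff]
          have : x < z := hz
          nlinarith
        · simp [Set.indicator_of_notMem hz]
    _ = ENNReal.ofReal (Real.exp (-x ^ 2 / 2)) := by
        rw [lintegral_const_mul _ (by fun_prop), lintegral_exp_mul_stdGaussian,
          ← ENNReal.ofReal_mul (Real.exp_pos _).le, ← Real.exp_add]
        congr 2
        ring

lemma stdGaussian_Iic_le {x : ℝ} (hx : x ≤ 0) :
    gaussianReal 0 1 (Set.Iic x) ≤ ENNReal.ofReal (Real.exp (-x ^ 2 / 2)) := by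
  calc gaussianReal 0 1 (Set.Iic x)
      = ∫⁻ z, (Set.Iic x).indicator 1 z ∂(gaussianReal 0 1) :=
        (lintegral_indicator_one measurableSet_Iic).symm
    _ ≤ ∫⁻ z, ENNReal.ofReal (Real.exp (-x ^ 2)) * ENNReal.ofReal (Real.exp (x * z))
          ∂(gaussianReal 0 1) := by
        refine lintegral_mono fun z => ?_
        by_cases hz : z ∈ Set.Iic x
        · rw [Set.indicator_of_mem hz, Pi.one_apply, ← ENNReal.ofReal_mul (Real.exp_pos _).le,
            ← Real.exp_add, ENNReal.one_le_ofReal, Real.one_le_exp_iff]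
          have : z ≤ x := hz
          nlinarith
        · simp [Set.indicator_of_notMem hz]
    _ = ENNReal.ofReal (Real.exp (-x ^ 2 / 2)) := by
        rw [lintegral_const_mul _ (by fun_prop), lintegral_exp_mul_stdGaussian,
          ← ENNReal.ofReal_mul (Real.exp_pos _).le, ← Real.exp_add]
        congr 2
        ring

/-- An anti-concentration bound: `P(Z > c) ≥ e^{-(c⁺)²} / (e √(2π))`. -/
lemma le_stdGaussian_Ioi (c : ℝ) :
    ENNReal.ofReal ((Real.exp 1 * √(2 * Real.pi))⁻¹ * Real.exp (-(max c 0) ^ 2)) ≤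
      gaussianReal 0 1 (Set.Ioi c) := by
  set d := max c 0 with hd
  have hd0 : 0 ≤ d := le_max_right _ _
  -- On this unit interval `z²/2 ≤ (d+1)²/2 ≤ d² + 1`, the last step being `(d-1)² ≥ 0`; integrating
  -- the density over it gives the bound.
  have hsub : Set.Ioc d (d + 1) ⊆ Set.Ioi c := fun z hz => (le_max_left c 0).trans_lt hz.1
  refine le_trans ?_ (measure_mono hsub)
  rw [gaussianReal_apply _ one_ne_zero]
  calc ENNReal.ofReal ((Real.exp 1 * √(2 * Real.pi))⁻¹ * Real.exp (-d ^ 2))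
      = ∫⁻ _ in Set.Ioc d (d + 1),
          ENNReal.ofReal ((Real.exp 1 * √(2 * Real.pi))⁻¹ * Real.exp (-d ^ 2)) := by
        simp
    _ ≤ ∫⁻ z in Set.Ioc d (d + 1), gaussianPDF 0 1 z := by
        refine setLIntegral_mono (measurable_gaussianPDF 0 1) fun z hz => ?_
        refine ENNReal.ofReal_le_ofReal ?_
        simp only [gaussianPDFReal, NNReal.coe_one, mul_one, sub_zero]
        rw [mul_inv, ← Real.exp_neg, mul_comm (Real.exp (-1)), mul_assoc, ← Real.exp_add]
        refine mul_le_mul_of_nonneg_left (Real.exp_le_exp.2 ?_) (by positivity)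
        have h1 := hz.1
        have h2 := hz.2
        nlinarith [sq_nonneg (d - 1)]

lemma stdGaussian_Ioi_pos (c : ℝ) : 0 < gaussianReal 0 1 (Set.Ioi c) :=
  lt_of_lt_of_le (ENNReal.ofReal_pos.2 (by positivity)) (le_stdGaussian_Ioi c)

/-- The odds that a standard Gaussian stays below `c`. -/
noncomputable def gaussianOdds (c : ℝ) : ℝ≥0∞ :=
  gaussianReal 0 1 (Set.Iic c) / gaussianReal 0 1 (Set.Ioi c)

lemma measurable_gaussianOdds : Measurable gaussianOdds := by
  have h1 : Monotone fun c : ℝ => gaussianReal 0 1 (Set.Iic c) :=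
    fun a b h => measure_mono (Set.Iic_subset_Iic.2 h)
  have h2 : Antitone fun c : ℝ => gaussianReal 0 1 (Set.Ioi c) :=
    fun a b h => measure_mono (Set.Ioi_subset_Ioi h)
  exact h1.measurable.div h2.measurable

lemma gaussianOdds_mul (c : ℝ) :
    gaussianOdds c * gaussianReal 0 1 (Set.Ioi c) = gaussianReal 0 1 (Set.Iic c) :=
  ENNReal.div_mul_cancel (stdGaussian_Ioi_pos c).ne' (measure_ne_top _ _)

lemma gaussianOdds_le_of_Iic_le {c b : ℝ}
    (h : gaussianReal 0 1 (Set.Iic c) ≤ ENNReal.ofReal b) :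
    gaussianOdds c ≤
      ENNReal.ofReal (Real.exp 1 * √(2 * Real.pi) * (b * Real.exp ((max c 0) ^ 2))) := by
  have hpos : 0 < (Real.exp 1 * √(2 * Real.pi))⁻¹ * Real.exp (-(max c 0) ^ 2) := by positivity
  calc gaussianOdds c ≤ ENNReal.ofReal b /
        ENNReal.ofReal ((Real.exp 1 * √(2 * Real.pi))⁻¹ * Real.exp (-(max c 0) ^ 2)) :=
        ENNReal.div_le_div h (le_stdGaussian_Ioi c)
    _ = _ := by
        rw [← ENNReal.ofReal_div_of_pos hpos]
        congr 1
        rw [Real.exp_neg]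
        field_simp

/-- If the shift `s * g` is at most `d/2`, the lower tail alone gives `exp(-d²/8)`. Otherwise the
numerator is bounded by 1 and the denominator costs at most `exp((s*g)²) ≤ exp(g²/4)`, while `d²/8 ≤
(s*g)²/2 ≤ g²/8`. Hence `3/8 = 1/4 + 1/8`. -/
lemma gaussianOdds_le {d s g : ℝ} (hd : 0 ≤ d) (hs0 : 0 ≤ s) (hs : s ≤ 1 / 2) :
    gaussianOdds (-d + s * g) ≤
      ENNReal.ofReal (Real.exp 1 * √(2 * Real.pi) * Real.exp (3 * g ^ 2 / 8 - d ^ 2 / 8)) := by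
  have hsg : (s * g) ^ 2 ≤ g ^ 2 / 4 := by
    have h4 : s ^ 2 ≤ 1 / 4 := by nlinarith
    rw [mul_pow]
    nlinarith [sq_nonneg g]
  rcases le_or_gt (-d + s * g) (-d / 2) with h | h
  · have hneg : -d + s * g ≤ 0 := by linarith
    refine (gaussianOdds_le_of_Iic_le (stdGaussian_Iic_le hneg)).trans
      (ENNReal.ofReal_le_ofReal (mul_le_mul_of_nonneg_left ?_ (by positivity)))
    rw [← Real.exp_add, max_eq_right hneg]
    refine Real.exp_le_exp.2 ?_
    nlinarith [sq_nonneg g]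
  · have hpos : d / 2 < s * g := by linarith
    refine (gaussianOdds_le_of_Iic_le (b := 1) (by simpa using prob_le_one)).trans
      (ENNReal.ofReal_le_ofReal (mul_le_mul_of_nonneg_left ?_ (by positivity)))
    rw [one_mul]
    refine Real.exp_le_exp.2 ?_
    have h1 : max (-d + s * g) 0 ≤ s * g := max_le (by linarith) (by linarith)
    have h2 : 0 ≤ max (-d + s * g) 0 := le_max_right _ _
    nlinarith

/-- Integrating out an independent variable. -/
lemma lintegral_comp_prodMk_of_indep {Ω E : Type*} [MeasurableSpace E] {m mΩ : MeasurableSpace Ω}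
    {P : Measure Ω} [IsProbabilityMeasure P] (hm : m ≤ mΩ) {W : Ω → E} {Y : Ω → ℝ}
    (hW : Measurable[m] W) (hY : Measurable Y)
    (hind : Indep m (MeasurableSpace.comap Y inferInstance) P)
    {ψ : E × ℝ → ℝ≥0∞} (hψ : Measurable ψ) :
    ∫⁻ ω, ψ (W ω, Y ω) ∂P = ∫⁻ ω, ∫⁻ z, ψ (W ω, z) ∂(P.map Y) ∂P := by
  have hW' : Measurable W := hW.mono hm le_rfl
  have hWY : IndepFun W Y P := indep_of_indep_of_le_left hind hW.comap_le
  have hmap := (indepFun_iff_map_prod_eq_prod_map_map hW'.aemeasurable hY.aemeasurable).1 hWY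
  have : IsProbabilityMeasure (P.map Y) := Measure.isProbabilityMeasure_map hY.aemeasurable
  have : IsProbabilityMeasure (P.map W) := Measure.isProbabilityMeasure_map hW'.aemeasurable
  calc ∫⁻ ω, ψ (W ω, Y ω) ∂P = ∫⁻ x, ψ x ∂(P.map fun ω => (W ω, Y ω)) :=
        (lintegral_map hψ (hW'.prodMk hY)).symm
    _ = ∫⁻ w, ∫⁻ z, ψ (w, z) ∂(P.map Y) ∂(P.map W) := by
        rw [hmap, lintegral_prod _ hψ.aemeasurable]
    _ = _ := lintegral_map hψ.lintegral_prod_right' hW'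

/-! ### Counts and sums along an adapted sequence of arms. -/

section Adapted

variable {K : ℕ} {Ω : Type*} {m : MeasurableSpace Ω} {A : ℕ → Ω → Fin K}

/-- The sum of the values of `Y` in those of the first `t` rounds in which arm `a` is pulled. -/
noncomputable def armSum (A : ℕ → Ω → Fin K) (Y : ℕ → Ω → ℝ) (a : Fin K) (t : ℕ) (ω : Ω) : ℝ :=
  ∑ s ∈ (Finset.range t).filter (fun s => A s ω = a), Y s ω

lemma measurableSet_arm_eq {t : ℕ} (hA : Measurable (A t)) (a : Fin K) :
    MeasurableSet {ω | A t ω = a} :=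
  hA (measurableSet_singleton a)

lemma measurable_pullCount {t : ℕ} (hA : ∀ s < t, Measurable (A s)) (a : Fin K) :
    Measurable (pullCount A a t) := by
  have : pullCount A a t = fun ω => ∑ s ∈ Finset.range t, if A s ω = a then 1 else 0 := by
    funext ω
    rw [pullCount, Finset.card_filter]
  rw [this]
  exact Finset.measurable_sum _ fun s hs =>
    Measurable.ite (measurableSet_arm_eq (hA s (Finset.mem_range.1 hs)) a)
      measurable_const measurable_const

lemma measurable_armSum {Y : ℕ → Ω → ℝ} {t : ℕ} (hA : ∀ s < t, Measurable (A s))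
    (hY : ∀ s < t, Measurable (Y s)) (a : Fin K) : Measurable (armSum A Y a t) := by
  have : armSum A Y a t = fun ω => ∑ s ∈ Finset.range t, if A s ω = a then Y s ω else 0 := by
    funext ω
    rw [armSum, Finset.sum_filter]
  rw [this]
  exact Finset.measurable_sum _ fun s hs =>
    Measurable.ite (measurableSet_arm_eq (hA s (Finset.mem_range.1 hs)) a)
      (hY s (Finset.mem_range.1 hs)) measurable_const

lemma measurable_sampleMean {X : ℕ → Ω → ℝ} {t : ℕ} (hA : ∀ s < t, Measurable (A s))
    (hX : ∀ s < t, Measurable (X s)) (a : Fin K) : Measurable (sampleMean A X a t) :=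
  (measurable_armSum hA hX a).div
    (measurable_from_nat.comp (measurable_pullCount hA a) : Measurable fun ω =>
      (pullCount A a t ω : ℝ))

lemma pullCount_succ (a : Fin K) (t : ℕ) (ω : Ω) :
    pullCount A a (t + 1) ω = pullCount A a t ω + if A t ω = a then 1 else 0 := by
  simp only [pullCount, Finset.card_filter, Finset.sum_range_succ]

lemma armSum_succ (Y : ℕ → Ω → ℝ) (a : Fin K) (t : ℕ) (ω : Ω) :
    armSum A Y a (t + 1) ω = armSum A Y a t ω + if A t ω = a then Y t ω else 0 := by
  simp only [armSum, Finset.sum_filter, Finset.sum_range_succ]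

lemma pullCount_le (a : Fin K) (t : ℕ) (ω : Ω) : pullCount A a t ω ≤ t :=
  (Finset.card_filter_le _ _).trans (Finset.card_range t).le

/-- At most `l` pulls of an arm happen while its count is below `l`. -/
lemma card_pulls_of_pullCount_lt (a : Fin K) (l t : ℕ) (ω : Ω) :
    (∑ s ∈ Finset.range t, if A s ω = a ∧ pullCount A a s ω < l then 1 else 0) =
      min (pullCount A a t ω) l := by
  induction t with
  | zero => simp [pullCount]
  | succ t ih =>
    rw [Finset.sum_range_succ, ih, pullCount_succ]
    by_cases h : A t ω = a <;> by_cases h' : pullCount A a t ω < l <;> simp [h, h'] <;> omega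

end Adapted

/-! ### Information available before each draw. -/

namespace StableTSRun

variable {K : ℕ} {Ω : Type*} [mΩ : MeasurableSpace Ω] {P : Measure Ω} {μ σ : Fin K → ℝ} {γ : ℝ}
  (R : StableTSRun P μ σ γ)

/-- All sources of randomness of a run. -/
def noise (R : StableTSRun P μ σ γ) : (Fin K × ℕ) ⊕ ℕ → Ω → ℝ :=
  Sum.elim (fun p : Fin K × ℕ => R.Z p.1 p.2) R.ξ

lemma measurable_noise (i : (Fin K × ℕ) ⊕ ℕ) : Measurable (R.noise i) := by
  rcases i with i | i
  · exact R.measurable_Z _ _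
  · exact R.measurable_ξ _

/-- The information carried by the sources with index in `S`. -/
@[reducible] def info (S : Set ((Fin K × ℕ) ⊕ ℕ)) : MeasurableSpace Ω :=
  ⨆ i ∈ S, MeasurableSpace.comap (R.noise i) inferInstance

lemma info_le (S : Set ((Fin K × ℕ) ⊕ ℕ)) : R.info S ≤ mΩ :=
  iSup₂_le fun i _ => (R.measurable_noise i).comap_le

lemma measurable_noise_info {S : Set ((Fin K × ℕ) ⊕ ℕ)} {i : (Fin K × ℕ) ⊕ ℕ} (hi : i ∈ S) :
    Measurable[R.info S] (R.noise i) :=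
  measurable_iff_comap_le.2 (le_iSup₂_of_le i hi le_rfl)

lemma indep_info {S : Set ((Fin K × ℕ) ⊕ ℕ)} {i : (Fin K × ℕ) ⊕ ℕ} (hi : i ∉ S) :
    Indep (R.info S) (MeasurableSpace.comap (R.noise i) inferInstance) P := by
  have h := indep_iSup_of_disjoint (fun i => (R.measurable_noise i).comap_le) R.indep
    (Set.disjoint_singleton_right.2 hi)
  rwa [iSup_singleton] at h

lemma measurable_arm_of_history {S : Set ((Fin K × ℕ) ⊕ ℕ)} {t : ℕ}
    (hA : ∀ s < t, Measurable[R.info S] (R.A s)) (hX : ∀ s < t, Measurable[R.info S] (R.X s))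
    (hZ : ∀ a, Measurable[R.info S] (R.Z a t)) : Measurable[R.info S] (R.A t) := by
  rcases lt_or_ge t K with h | h
  · have : R.A t = fun _ => ⟨t, h⟩ := funext fun ω => Fin.ext (R.arm_init t ω h)
    rw [this]
    exact measurable_const
  · rw [funext fun ω => R.arm_step t ω h]
    refine R.measurable_argmax.comp
      (@measurable_pi_lambda Ω (Fin K) (fun _ => ℝ) (R.info S) _ _ fun a => ?_)
    have h1 := measurable_sampleMean hA hX a
    have h2 := (measurable_from_nat : Measurable fun n : ℕ => √(γ / (n : ℝ))).comp
      (measurable_pullCount hA a)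
    exact h1.add (h2.mul (hZ a))

/-- Arms and rewards determine each other in turn, so both are handled in one induction. The set `S`
is left general because the reward draw and the sample draw need different ones. -/
lemma measurable_history {S : Set ((Fin K × ℕ) ⊕ ℕ)} (t : ℕ)
    (hZ : ∀ a, ∀ s < t, Sum.inl (a, s) ∈ S) (hξ : ∀ s < t, Sum.inr s ∈ S) :
    (∀ s < t, Measurable[R.info S] (R.A s)) ∧ ∀ s < t, Measurable[R.info S] (R.X s) := by
  induction t with
  | zero => exact ⟨fun s hs => absurd hs (by omega), fun s hs => absurd hs (by omega)⟩
  | succ t ih =>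
    obtain ⟨hA, hX⟩ := ih (fun a s hs => hZ a s (by omega)) (fun s hs => hξ s (by omega))
    have hAt : Measurable[R.info S] (R.A t) := R.measurable_arm_of_history hA hX
      fun a => R.measurable_noise_info (hZ a t (by omega))
    have hXt : Measurable[R.info S] (R.X t) := by
      rw [funext fun ω => R.reward t ω]
      exact ((measurable_of_finite μ).comp hAt).add (((measurable_of_finite σ).comp hAt).mul
        (R.measurable_noise_info (hξ t (by omega))))
    refine ⟨fun s hs => ?_, fun s hs => ?_⟩
    · rcases Nat.lt_succ_iff_lt_or_eq.1 hs with h | rfl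
      exacts [hA s h, hAt]
    · rcases Nat.lt_succ_iff_lt_or_eq.1 hs with h | rfl
      exacts [hX s h, hXt]

/-- The sources available when the reward of round `t + 1` is drawn. -/
def beforeReward (K t : ℕ) : Set ((Fin K × ℕ) ⊕ ℕ) :=
  {i | Sum.elim (fun p => p.2 ≤ t) (fun s => s < t) i}

/-- The sources available when the posterior sample of arm `b` in round `t + 1` is drawn last. -/
def beforeSample (b : Fin K) (t : ℕ) : Set ((Fin K × ℕ) ⊕ ℕ) :=
  {i | Sum.elim (fun p => p.2 < t ∨ p.2 = t ∧ p.1 ≠ b) (fun s => s < t) i}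

lemma measurable_history_beforeReward (t : ℕ) :
    (∀ s ≤ t, Measurable[R.info (beforeReward K t)] (R.A s)) ∧
      (∀ s < t, Measurable[R.info (beforeReward K t)] (R.X s)) ∧
      ∀ s < t, Measurable[R.info (beforeReward K t)] (R.ξ s) := by
  obtain ⟨hA, hX⟩ := R.measurable_history (S := beforeReward K t) t
    (fun a s hs => hs.le) (fun s hs => hs)
  refine ⟨fun s hs => ?_, hX, fun s hs => R.measurable_noise_info (i := Sum.inr s) hs⟩
  rcases hs.lt_or_eq with h | rfl
  · exact hA s h
  · exact R.measurable_arm_of_history hA hX fun a =>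
      R.measurable_noise_info (i := Sum.inl (a, s)) (le_refl s)

lemma measurable_history_beforeSample (b : Fin K) (t : ℕ) :
    (∀ s < t, Measurable[R.info (beforeSample b t)] (R.A s)) ∧
      (∀ s < t, Measurable[R.info (beforeSample b t)] (R.X s)) ∧
      (∀ s < t, Measurable[R.info (beforeSample b t)] (R.ξ s)) ∧
      ∀ a ≠ b, Measurable[R.info (beforeSample b t)] (R.Z a t) := by
  obtain ⟨hA, hX⟩ := R.measurable_history (S := beforeSample b t) t
    (fun a s hs => Or.inl hs) (fun s hs => hs)
  exact ⟨hA, hX, fun s hs => R.measurable_noise_info (i := Sum.inr s) hs,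
    fun a ha => R.measurable_noise_info (i := Sum.inl (a, t)) (Or.inr ⟨rfl, ha⟩)⟩

lemma indep_beforeReward (t : ℕ) :
    Indep (R.info (beforeReward K t)) (MeasurableSpace.comap (R.ξ t) inferInstance) P :=
  R.indep_info (i := Sum.inr t) (lt_irrefl t)

lemma indep_beforeSample (b : Fin K) (t : ℕ) :
    Indep (R.info (beforeSample b t)) (MeasurableSpace.comap (R.Z b t) inferInstance) P :=
  R.indep_info (i := Sum.inl (b, t)) fun h => by
    rcases h with h | h
    · exact lt_irrefl t h
    · exact h.2 rfl

lemma measurable_A (t : ℕ) : Measurable (R.A t) :=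
  ((R.measurable_history_beforeReward t).1 t le_rfl).mono (R.info_le _) le_rfl

lemma measurable_count (a : Fin K) (t : ℕ) : Measurable (pullCount R.A a t) :=
  measurable_pullCount (fun s _ => R.measurable_A s) a

lemma measurable_noiseSum (a : Fin K) (t : ℕ) : Measurable (armSum R.A R.ξ a t) :=
  measurable_armSum (fun s _ => R.measurable_A s) (fun s _ => R.measurable_ξ s) a

lemma sampleMean_eq (a : Fin K) {t : ℕ} {ω : Ω} (hn : 0 < pullCount R.A a t ω) :
    sampleMean R.A R.X a t ω =
      μ a + σ a * armSum R.A R.ξ a t ω / (pullCount R.A a t ω : ℝ) := by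
  have hn' : (pullCount R.A a t ω : ℝ) ≠ 0 := by positivity
  have : ∑ s ∈ (Finset.range t).filter (fun s => R.A s ω = a), R.X s ω =
      (pullCount R.A a t ω : ℝ) * μ a + σ a * armSum R.A R.ξ a t ω := by
    rw [armSum, Finset.mul_sum, pullCount, ← nsmul_eq_mul, ← Finset.sum_const,
      ← Finset.sum_add_distrib]
    refine Finset.sum_congr rfl fun s hs => ?_
    rw [R.reward, (Finset.mem_filter.1 hs).2]
  rw [sampleMean, this]
  field_simp

lemma one_le_pullCount (a : Fin K) {t : ℕ} (ht : K ≤ t) (ω : Ω) : 1 ≤ pullCount R.A a t ω :=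
  Finset.card_pos.2 ⟨a, Finset.mem_filter.2 ⟨Finset.mem_range.2 (a.2.trans_le ht),
    Fin.ext (R.arm_init a ω a.2)⟩⟩

lemma pullCount_eq_zero {a : Fin K} {t : ℕ} (ht : t < K) {ω : Ω} (h : R.A t ω = a) :
    pullCount R.A a t ω = 0 := by
  refine Finset.card_eq_zero.2 (Finset.filter_eq_empty_iff.2 fun s hs h' => ?_)
  have hs := Finset.mem_range.1 hs
  have h1 := R.arm_init t ω ht
  have h2 := R.arm_init s ω (hs.trans ht)
  rw [h] at h1
  rw [h'] at h2
  omega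

/-! ### The exponential martingale stopped at a given pull. -/

lemma lintegral_exp_noise (l : ℝ) (t : ℕ) :
    ∫⁻ ω, ENNReal.ofReal (Real.exp (l * R.ξ t ω - l ^ 2 / 2)) ∂P = 1 := by
  have h1 : ∀ x : ℝ, ENNReal.ofReal (Real.exp (l * x - l ^ 2 / 2)) =
      ENNReal.ofReal (Real.exp (-(l ^ 2 / 2))) * ENNReal.ofReal (Real.exp (l * x)) := fun x => by
    rw [← ENNReal.ofReal_mul (Real.exp_pos _).le, ← Real.exp_add]
    congr 2
    ring
  have h2 : ∫⁻ ω, ENNReal.ofReal (Real.exp (l * R.ξ t ω)) ∂P =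
      ∫⁻ z, ENNReal.ofReal (Real.exp (l * z)) ∂(P.map (R.ξ t)) :=
    (lintegral_map (f := fun z => ENNReal.ofReal (Real.exp (l * z))) (by fun_prop)
      (R.measurable_ξ t)).symm
  simp_rw [h1]
  rw [lintegral_const_mul _ (by have := R.measurable_ξ t; fun_prop), h2, R.law_ξ,
    lintegral_exp_mul_stdGaussian, ← ENNReal.ofReal_mul (Real.exp_pos _).le, ← Real.exp_add]
  simp

/-- The exponential martingale of the rewards of arm `a`. -/
noncomputable def expMart (R : StableTSRun P μ σ γ) (a : Fin K) (l : ℝ) (t : ℕ) (ω : Ω) : ℝ≥0∞ :=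
  ENNReal.ofReal (Real.exp (l * armSum R.A R.ξ a t ω - l ^ 2 / 2 * (pullCount R.A a t ω : ℝ)))

lemma measurable_expMart_beforeReward (a : Fin K) (l : ℝ) (t : ℕ) :
    Measurable[R.info (beforeReward K t)] (R.expMart a l t) := by
  obtain ⟨hA, -, hξ⟩ := R.measurable_history_beforeReward t
  have h1 := measurable_armSum (fun s hs => hA s hs.le) hξ a
  have h2 := (measurable_from_nat : Measurable fun n : ℕ => (n : ℝ)).comp
    (measurable_pullCount (fun s (hs : s < t) => hA s hs.le) a)
  exact ENNReal.measurable_ofReal.comp (Real.measurable_exp.comp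
    ((measurable_const.mul h1).sub (measurable_const.mul h2)))

lemma measurable_ite_expMart (a : Fin K) (l : ℝ) (t : ℕ) {q : Fin K → ℕ → Prop}
    [∀ b n, Decidable (q b n)] : Measurable[R.info (beforeReward K t)]
      fun ω => if q (R.A t ω) (pullCount R.A a t ω) then R.expMart a l t ω else 0 := by
  obtain ⟨hA, -, hξ⟩ := R.measurable_history_beforeReward t
  refine Measurable.ite ?_ (R.measurable_expMart_beforeReward a l t) measurable_const
  exact ((hA t le_rfl).prodMk (measurable_pullCount (fun s hs => hA s hs.le) a))
    (Set.to_countable {x : Fin K × ℕ | q x.1 x.2}).measurableSet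

/-- Optional stopping of `expMart` at the pull number `k + 1`. -/
lemma lintegral_expMart_stopped [IsProbabilityMeasure P] (a : Fin K) (l : ℝ) (k t : ℕ) :
    ∫⁻ ω, (if pullCount R.A a t ω ≤ k then R.expMart a l t ω else 0) ∂P +
      ∑ s ∈ Finset.range t,
        ∫⁻ ω, (if R.A s ω = a ∧ pullCount R.A a s ω = k then R.expMart a l s ω else 0) ∂P = 1 := by
  induction t with
  | zero => simp [pullCount, expMart, armSum]
  | succ t ih =>
    have hm1 := R.measurable_ite_expMart a l t (q := fun b n => b ≠ a ∧ n ≤ k)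
    have hm2 := R.measurable_ite_expMart a l t (q := fun b n => b = a ∧ n < k)
    have hm3 := R.measurable_ite_expMart a l t (q := fun b n => b = a ∧ n = k)
    have hle := R.info_le (beforeReward K t)
    -- The three ways to be unstopped before the round: `a` is not pulled, is pulled and stays
    -- within `k` pulls, or makes its pull number `k + 1`. `f₃` moves into the sum of stopped
    -- values, and `f₂` gains the independent factor `e` of mean one.
    set f₁ : Ω → ℝ≥0∞ := fun ω =>
      if R.A t ω ≠ a ∧ pullCount R.A a t ω ≤ k then R.expMart a l t ω else 0
    set f₂ : Ω → ℝ≥0∞ := fun ω =>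
      if R.A t ω = a ∧ pullCount R.A a t ω < k then R.expMart a l t ω else 0
    set f₃ : Ω → ℝ≥0∞ := fun ω =>
      if R.A t ω = a ∧ pullCount R.A a t ω = k then R.expMart a l t ω else 0
    set e : Ω → ℝ≥0∞ := fun ω => ENNReal.ofReal (Real.exp (l * R.ξ t ω - l ^ 2 / 2)) with he
    have hme : Measurable[MeasurableSpace.comap (R.ξ t) inferInstance] e :=
      (by fun_prop : Measurable fun x : ℝ =>
        ENNReal.ofReal (Real.exp (l * x - l ^ 2 / 2))).comp (comap_measurable (R.ξ t))
    have hmul : ∫⁻ ω, f₂ ω * e ω ∂P = ∫⁻ ω, f₂ ω ∂P := by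
      rw [lintegral_mul_eq_lintegral_mul_lintegral_of_independent_measurableSpace hle
        (R.measurable_ξ t).comap_le (R.indep_beforeReward t) hm2 hme,
        R.lintegral_exp_noise, mul_one]
    have hsplit : ∀ ω, (if pullCount R.A a t ω ≤ k then R.expMart a l t ω else 0) =
        f₁ ω + (f₂ ω + f₃ ω) := fun ω => by
      simp only [f₁, f₂, f₃]
      by_cases h : R.A t ω = a
      · rcases lt_trichotomy (pullCount R.A a t ω) k with h' | h' | h'
        · simp [h, h', h'.le, h'.ne]
        · simp [h, h']
        · simp [h, h'.not_ge, h'.ne', h'.not_gt]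
      · simp [h]
    have hstep : ∀ ω, (if pullCount R.A a (t + 1) ω ≤ k then R.expMart a l (t + 1) ω else 0) =
        f₁ ω + f₂ ω * e ω := fun ω => by
      simp only [f₁, f₂, he, expMart, pullCount_succ, armSum_succ]
      by_cases h : R.A t ω = a
      · by_cases h' : pullCount R.A a t ω < k
        · simp only [h, h', if_true, ne_eq, not_true_eq_false, false_and, true_and, if_false,
            zero_add, Nat.succ_le_of_lt h']
          rw [← ENNReal.ofReal_mul (Real.exp_pos _).le, ← Real.exp_add]
          congr 2
          push_cast
          ring
        · simp [h, h', show ¬ pullCount R.A a t ω + 1 ≤ k from h']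
      · simp [h]
    rw [Finset.sum_range_succ, lintegral_congr hstep,
      lintegral_add_left (hm1.mono hle le_rfl), hmul, ← ih, lintegral_congr hsplit,
      lintegral_add_left (hm1.mono hle le_rfl), lintegral_add_left (hm2.mono hle le_rfl)]
    ring

lemma measurable_ite_count {f : Ω → ℝ≥0∞} (hf : Measurable f) (a : Fin K) (t : ℕ)
    {q : Fin K → ℕ → Prop} [∀ b n, Decidable (q b n)] :
    Measurable fun ω => if q (R.A t ω) (pullCount R.A a t ω) then f ω else 0 :=
  Measurable.ite (((R.measurable_A t).prodMk (R.measurable_count a t))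
    (Set.to_countable {x : Fin K × ℕ | q x.1 x.2}).measurableSet) hf measurable_const

end StableTSRun

lemma sum_exp_neg_mul_le {c : ℝ} (hc : 0 < c) (T : ℕ) :
    ∑ k ∈ Finset.Ico 1 T, Real.exp (-(c * k)) ≤ 1 / c := by
  -- Keeping the term `exp(-c n)` lets the induction close through `1 + c ≤ exp c`.
  have key : ∀ n : ℕ, ∑ k ∈ Finset.range n, Real.exp (-(c * ((1 + k : ℕ) : ℝ))) ≤
      (1 - Real.exp (-(c * n))) / c := by
    intro n
    induction n with
    | zero => simp
    | succ n ih =>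
      rw [Finset.sum_range_succ]
      have h1 : Real.exp (-(c * n)) = Real.exp c * Real.exp (-(c * ((1 + n : ℕ) : ℝ))) := by
        rw [← Real.exp_add]
        congr 1
        push_cast
        ring
      have h2 := Real.add_one_le_exp c
      have h3 := Real.exp_pos (-(c * ((1 + n : ℕ) : ℝ)))
      rw [le_div_iff₀ hc] at ih ⊢
      rw [add_comm n 1]
      nlinarith
  rw [Finset.sum_Ico_eq_sum_range]
  exact (key _).trans (div_le_div_of_nonneg_right (by linarith [Real.exp_pos (-(c * (T - 1 : ℕ)))])
    hc.le)

/-! ### Exponential moments of the squared noise sum at pulls. -/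

namespace StableTSRun

variable {K : ℕ} {Ω : Type*} [mΩ : MeasurableSpace Ω] {P : Measure Ω} {μ σ : Fin K → ℝ} {γ : ℝ}
  (R : StableTSRun P μ σ γ)

/-- When arm `a` is pulled for the `(k + 1)`-st time, its noise sum is sub-Gaussian. -/
lemma sum_lintegral_exp_sq_le [IsProbabilityMeasure P] (a : Fin K) {k : ℕ} (hk : 0 < k) (T : ℕ) :
    ∑ s ∈ Finset.range T, ∫⁻ ω, (if R.A s ω = a ∧ pullCount R.A a s ω = k then
      ENNReal.ofReal (Real.exp (3 * armSum R.A R.ξ a s ω ^ 2 / (8 * k))) else 0) ∂P ≤ 2 := by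
  have hk' : (0 : ℝ) < k := by positivity
  -- At count `k` the compensator of `expMart a (u * l)` is then `3l²/8`. The mixing weight cancels
  -- it, and integrating `exp(u S l)` over a Gaussian `l` yields `exp(3S²/(8k))`.
  set u : ℝ := √(3 / (4 * k)) with hu
  have hu2 : u ^ 2 = 3 / (4 * k) := Real.sq_sqrt (by positivity)
  have hmeas : ∀ s, Measurable (Function.uncurry fun (ω : Ω) (l : ℝ) =>
      if R.A s ω = a ∧ pullCount R.A a s ω = k then R.expMart a (u * l) s ω else 0) := fun s => by
    have h1 := (R.measurable_noiseSum a s).comp (measurable_fst : Measurable (Prod.fst : Ω × ℝ → Ω))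
    have h2 := ((measurable_from_nat : Measurable fun n : ℕ => (n : ℝ)).comp
      (R.measurable_count a s)).comp (measurable_fst : Measurable (Prod.fst : Ω × ℝ → Ω))
    have hset : MeasurableSet {p : Ω × ℝ | R.A s p.1 = a ∧ pullCount R.A a s p.1 = k} :=
      (((R.measurable_A s).prodMk (R.measurable_count a s)).comp (measurable_fst : Measurable (Prod.fst : Ω × ℝ → Ω)))
        (measurableSet_singleton (a, k)) |>.congr (by ext; simp)
    refine Measurable.ite hset ?_ measurable_const
    simp only [Function.comp_def] at h1 h2
    unfold expMart
    fun_prop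
  have hrep : ∀ s ω, (if R.A s ω = a ∧ pullCount R.A a s ω = k then
      ENNReal.ofReal (Real.exp (3 * armSum R.A R.ξ a s ω ^ 2 / (8 * k))) else 0) =
      ∫⁻ l, (if R.A s ω = a ∧ pullCount R.A a s ω = k then R.expMart a (u * l) s ω else 0) *
        ENNReal.ofReal (Real.exp (3 * l ^ 2 / 8)) ∂(gaussianReal 0 1) := fun s ω => by
    by_cases h : R.A s ω = a ∧ pullCount R.A a s ω = k
    · simp only [h, and_self, if_true]
      have h1 : ∀ l : ℝ, R.expMart a (u * l) s ω * ENNReal.ofReal (Real.exp (3 * l ^ 2 / 8)) =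
          ENNReal.ofReal (Real.exp ((u * armSum R.A R.ξ a s ω) * l)) := fun l => by
        rw [expMart, ← ENNReal.ofReal_mul (Real.exp_pos _).le, ← Real.exp_add, h.2, mul_pow, hu2]
        congr 2
        field_simp
        ring
      simp_rw [h1]
      rw [lintegral_exp_mul_stdGaussian, mul_pow, hu2]
      congr 2
      field_simp
      ring
    · simp [h]
  calc _ = ∑ s ∈ Finset.range T, ∫⁻ l, ∫⁻ ω,
        (if R.A s ω = a ∧ pullCount R.A a s ω = k then R.expMart a (u * l) s ω else 0) *
        ENNReal.ofReal (Real.exp (3 * l ^ 2 / 8)) ∂P ∂(gaussianReal 0 1) := by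
        refine Finset.sum_congr rfl fun s _ => ?_
        simp_rw [hrep s]
        exact lintegral_lintegral_swap
          ((hmeas s).mul (by fun_prop : Measurable fun p : Ω × ℝ =>
            ENNReal.ofReal (Real.exp (3 * p.2 ^ 2 / 8)))).aemeasurable
    _ = ∫⁻ l, (∑ s ∈ Finset.range T, ∫⁻ ω,
        (if R.A s ω = a ∧ pullCount R.A a s ω = k then R.expMart a (u * l) s ω else 0) ∂P) *
        ENNReal.ofReal (Real.exp (3 * l ^ 2 / 8)) ∂(gaussianReal 0 1) := by
        rw [← lintegral_finsetSum]
        · refine lintegral_congr fun l => ?_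
          rw [Finset.sum_mul]
          refine Finset.sum_congr rfl fun s _ => ?_
          exact lintegral_mul_const _ ((hmeas s).comp (measurable_id.prodMk measurable_const))
        · intro s _
          exact (((hmeas s).mul (by fun_prop : Measurable fun p : Ω × ℝ =>
            ENNReal.ofReal (Real.exp (3 * p.2 ^ 2 / 8)))).comp measurable_swap).lintegral_prod_right'
    _ ≤ ∫⁻ l, ENNReal.ofReal (Real.exp (3 * l ^ 2 / 8)) ∂(gaussianReal 0 1) := by
        refine lintegral_mono fun l => mul_le_of_le_one_left' ?_
        rw [← R.lintegral_expMart_stopped a (u * l) k T]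
        exact le_add_self
    _ = 2 := lintegral_exp_sq_stdGaussian

/-- Slicing by the value `k` of the count, each slice contributes at most `2 exp(-c k)`. Since `k`
starts at 1, the series is at most `2/c`. -/
lemma sum_lintegral_exp_sq_sub_le [IsProbabilityMeasure P] (a : Fin K) {c : ℝ} (hc : 0 < c)
    (T : ℕ) :
    ∑ s ∈ Finset.range T, ∫⁻ ω, (if R.A s ω = a ∧ 1 ≤ pullCount R.A a s ω then
      ENNReal.ofReal (Real.exp (3 * armSum R.A R.ξ a s ω ^ 2 / (8 * pullCount R.A a s ω) -
        c * pullCount R.A a s ω)) else 0) ∂P ≤ ENNReal.ofReal (2 / c) := by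
  have hmeas : ∀ s k, Measurable fun ω => if R.A s ω = a ∧ pullCount R.A a s ω = k then
      ENNReal.ofReal (Real.exp (3 * armSum R.A R.ξ a s ω ^ 2 / (8 * k))) else 0 := fun s k => by
    have h := R.measurable_noiseSum a s
    exact R.measurable_ite_count (by fun_prop) a s (q := fun b n => b = a ∧ n = k)
  calc _ ≤ ∑ s ∈ Finset.range T, ∫⁻ ω, ∑ k ∈ Finset.Ico 1 T,
        ENNReal.ofReal (Real.exp (-(c * k))) * (if R.A s ω = a ∧ pullCount R.A a s ω = k then
        ENNReal.ofReal (Real.exp (3 * armSum R.A R.ξ a s ω ^ 2 / (8 * k))) else 0) ∂P := by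
        refine Finset.sum_le_sum fun s hs => lintegral_mono fun ω => ?_
        split_ifs with h
        · have hmem : pullCount R.A a s ω ∈ Finset.Ico 1 T :=
            Finset.mem_Ico.2 ⟨h.2, (pullCount_le a s ω).trans_lt (Finset.mem_range.1 hs)⟩
          refine le_trans (le_of_eq ?_) (Finset.single_le_sum (fun _ _ => zero_le) hmem)
          rw [if_pos ⟨h.1, rfl⟩, ← ENNReal.ofReal_mul (Real.exp_pos _).le, ← Real.exp_add]
          congr 2
          ring
        · exact zero_le
    _ = ∑ k ∈ Finset.Ico 1 T, ENNReal.ofReal (Real.exp (-(c * k))) * ∑ s ∈ Finset.range T,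
        ∫⁻ ω, (if R.A s ω = a ∧ pullCount R.A a s ω = k then
        ENNReal.ofReal (Real.exp (3 * armSum R.A R.ξ a s ω ^ 2 / (8 * k))) else 0) ∂P := by
        simp_rw [Finset.mul_sum]
        rw [Finset.sum_comm]
        refine Finset.sum_congr rfl fun s _ => ?_
        rw [lintegral_finsetSum _ fun k _ => (hmeas s k).const_mul _]
        exact Finset.sum_congr rfl fun k _ => lintegral_const_mul _ (hmeas s k)
    _ ≤ ∑ k ∈ Finset.Ico 1 T, ENNReal.ofReal (Real.exp (-(c * k))) * ENNReal.ofReal 2 := by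
        refine Finset.sum_le_sum fun k hk => mul_le_mul_right ?_ _
        rw [ENNReal.ofReal_ofNat]
        exact R.sum_lintegral_exp_sq_le a (Finset.mem_Ico.1 hk).1 T
    _ ≤ ENNReal.ofReal (2 / c) := by
        rw [← Finset.sum_mul, ← ENNReal.ofReal_sum_of_nonneg fun _ _ => (Real.exp_pos _).le,
          ← ENNReal.ofReal_mul (Finset.sum_nonneg fun _ _ => (Real.exp_pos _).le)]
        refine ENNReal.ofReal_le_ofReal ?_
        have := sum_exp_neg_mul_le hc T
        calc _ ≤ 1 / c * 2 := by gcongr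
          _ = 2 / c := by ring

/-! ### Comparison of low samples with pulls of a best arm. -/

/-- The posterior sample of arm `a` in round `t + 1`. -/
noncomputable def sample (R : StableTSRun P μ σ γ) (a : Fin K) (t : ℕ) (ω : Ω) : ℝ :=
  sampleMean R.A R.X a t ω + √(γ / (pullCount R.A a t ω : ℝ)) * R.Z a t ω

lemma sample_le_of_arm_eq {a j : Fin K} {t : ℕ} (ht : K ≤ t) {ω : Ω} (h : R.A t ω = j) :
    R.sample a t ω ≤ R.sample j t ω := by
  have := R.le_argmax (fun a => R.sample a t ω) a
  rwa [show R.argmax (fun a => R.sample a t ω) = j from (R.arm_step t ω ht).symm.trans h] at this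

lemma measurable_sample_info {S : Set ((Fin K × ℕ) ⊕ ℕ)} {t : ℕ} {a : Fin K}
    (hA : ∀ s < t, Measurable[R.info S] (R.A s)) (hX : ∀ s < t, Measurable[R.info S] (R.X s))
    (hZ : Measurable[R.info S] (R.Z a t)) : Measurable[R.info S] (R.sample a t) :=
  (measurable_sampleMean hA hX a).add
    (((measurable_from_nat : Measurable fun n : ℕ => √(γ / (n : ℝ))).comp
      (measurable_pullCount hA a)).mul hZ)

/-- The comparison of a round in which arm `j` wins with a low posterior sample and one in which
arm `b` is pulled. -/
lemma measure_arm_sample_le [IsProbabilityMeasure P] (hγ : 0 < γ) {b j : Fin K}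
    {t : ℕ} (ht : K ≤ t) (y : ℝ) :
    ∫⁻ ω, (if R.A t ω = j ∧ R.sample j t ω ≤ y then 1 else 0) ∂P ≤
      ∫⁻ ω, (if R.A t ω = b then gaussianOdds ((y - sampleMean R.A R.X b t ω) /
        √(γ / (pullCount R.A b t ω : ℝ))) else 0) ∂P := by
  obtain ⟨hA, hX, -, hZ⟩ := R.measurable_history_beforeSample b t
  set c : Ω → ℝ := fun ω => (y - sampleMean R.A R.X b t ω) / √(γ / (pullCount R.A b t ω : ℝ))
    with hcdef
  have hc : Measurable[R.info (beforeSample b t)] c :=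
    (measurable_const.sub (measurable_sampleMean hA hX b)).div
      ((measurable_from_nat : Measurable fun n : ℕ => √(γ / (n : ℝ))).comp
        (measurable_pullCount hA b))
  -- `B` concerns the arms other than `b` only, so `B` and the standardized threshold `c` are known
  -- before `Z b t` is drawn.
  set B : Set Ω := ⋂ a ∈ {a : Fin K | a ≠ b}, {ω | R.sample a t ω ≤ y} with hBdef
  have hB : MeasurableSet[R.info (beforeSample b t)] B :=
    MeasurableSet.biInter (Set.to_countable _) fun a ha =>
      R.measurable_sample_info hA hX (hZ a ha) measurableSet_Iic
  set f : Ω → ℝ≥0∞ := B.indicator (fun _ => 1) with hfdef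
  have hf : Measurable[R.info (beforeSample b t)] f :=
    (@measurable_const ℝ≥0∞ Ω _ (R.info (beforeSample b t)) 1).indicator hB
  have hsamp : ∀ ω, R.sample b t ω ≤ y ↔ R.Z b t ω ≤ c ω := fun ω => by
    have hn : (0 : ℝ) < pullCount R.A b t ω := by exact_mod_cast R.one_le_pullCount b ht ω
    have : 0 < √(γ / (pullCount R.A b t ω : ℝ)) := Real.sqrt_pos.2 (by positivity)
    rw [hcdef, le_div_iff₀ this, sample, ← le_sub_iff_add_le', mul_comm]
  have hle : MeasurableSet {p : (ℝ≥0∞ × ℝ) × ℝ | p.2 ≤ p.1.2} :=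
    measurableSet_le (by fun_prop) (by fun_prop)
  have hlt : MeasurableSet {p : (ℝ≥0∞ × ℝ) × ℝ | p.1.2 < p.2} :=
    measurableSet_lt (by fun_prop) (by fun_prop)
  set ψ₁ : (ℝ≥0∞ × ℝ) × ℝ → ℝ≥0∞ := fun p => p.1.1 * {p | p.2 ≤ p.1.2}.indicator 1 p with hψ₁
  set ψ₂ : (ℝ≥0∞ × ℝ) × ℝ → ℝ≥0∞ := fun p =>
    p.1.1 * gaussianOdds p.1.2 * {p | p.1.2 < p.2}.indicator 1 p with hψ₂
  have hm₁ : Measurable ψ₁ := (by fun_prop : Measurable fun p : (ℝ≥0∞ × ℝ) × ℝ => p.1.1).mul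
    (measurable_one.indicator hle)
  have hm₂ : Measurable ψ₂ := ((by fun_prop : Measurable fun p : (ℝ≥0∞ × ℝ) × ℝ => p.1.1).mul
    (measurable_gaussianOdds.comp (by fun_prop))).mul (measurable_one.indicator hlt)
  have hint₁ : ∀ w, ∫⁻ z, ψ₁ (w, z) ∂(gaussianReal 0 1) =
      w.1 * gaussianReal 0 1 (Set.Iic w.2) := fun w => by
    have : ∀ z, ψ₁ (w, z) = w.1 * (Set.Iic w.2).indicator 1 z := fun z => rfl
    simp_rw [this]
    rw [lintegral_const_mul _ (measurable_one.indicator measurableSet_Iic),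
      lintegral_indicator_one measurableSet_Iic]
  have hint₂ : ∀ w, ∫⁻ z, ψ₂ (w, z) ∂(gaussianReal 0 1) =
      w.1 * gaussianReal 0 1 (Set.Iic w.2) := fun w => by
    have : ∀ z, ψ₂ (w, z) = w.1 * gaussianOdds w.2 * (Set.Ioi w.2).indicator 1 z := fun z => rfl
    simp_rw [this]
    rw [lintegral_const_mul _ (measurable_one.indicator measurableSet_Ioi),
      lintegral_indicator_one measurableSet_Ioi, mul_assoc, gaussianOdds_mul]
  -- Integrating out `Z b t` turns both sides into the integral of `f` times the probability of
  -- staying below `c`, since the odds convert the upper tail into the lower one.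
  have hswap : ∫⁻ ω, ψ₁ ((f ω, c ω), R.Z b t ω) ∂P = ∫⁻ ω, ψ₂ ((f ω, c ω), R.Z b t ω) ∂P := by
    rw [lintegral_comp_prodMk_of_indep (W := fun ω => (f ω, c ω)) (R.info_le _) (hf.prodMk hc)
      (R.measurable_Z b t) (R.indep_beforeSample b t) hm₁,
      lintegral_comp_prodMk_of_indep (W := fun ω => (f ω, c ω)) (R.info_le _) (hf.prodMk hc)
      (R.measurable_Z b t) (R.indep_beforeSample b t) hm₂, R.law_Z]
    simp_rw [hint₁, hint₂]
  -- If `j` wins with a sample below `y`, all samples are below `y`. Conversely, on `B` a sample of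
  -- `b` above `y` forces `b` to be pulled.
  refine le_trans (lintegral_mono fun ω => ?_) (hswap.le.trans (lintegral_mono fun ω => ?_))
  · split_ifs with h
    · have hall : ∀ a, R.sample a t ω ≤ y := fun a => (R.sample_le_of_arm_eq ht h.1).trans h.2
      have h1 : ω ∈ B := Set.mem_iInter₂.2 fun a _ => hall a
      have h2 : R.Z b t ω ≤ c ω := (hsamp ω).1 (hall b)
      simp [hψ₁, hfdef, h1, h2]
    · exact zero_le
  · by_cases h1 : ω ∈ B
    · by_cases h2 : c ω < R.Z b t ω
      · have hb : R.A t ω = b := by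
          by_contra hne
          have h3 := R.sample_le_of_arm_eq (a := b) ht (rfl : R.A t ω = _)
          have h4 : R.sample (R.A t ω) t ω ≤ y := Set.mem_iInter₂.1 h1 (R.A t ω) hne
          exact absurd ((hsamp ω).1 (h3.trans h4)) h2.not_ge
        rw [if_pos hb]
        calc ψ₂ ((f ω, c ω), R.Z b t ω) = gaussianOdds (c ω) := by simp [hψ₂, hfdef, h1, h2]
          _ ≤ _ := le_rfl
      · simp [hψ₂, h2]
    · simp [hψ₂, hfdef, h1]

/-- Standardizing gives `gaussianOdds_le` with `d = D√n/(2√γ)`, `s = σ b/√γ` and `g = -S/√n`. The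
condition `s ≤ 1/2` is exactly `4σ² ≤ γ`. -/
lemma gaussianOdds_threshold_le (hγ : 0 < γ) {b : Fin K} (hσ : 0 < σ b) (hσγ : 4 * σ b ^ 2 ≤ γ)
    {D : ℝ} (hD : 0 < D) {t : ℕ} {ω : Ω} (hn : 1 ≤ pullCount R.A b t ω) :
    gaussianOdds ((μ b - D / 2 - sampleMean R.A R.X b t ω) /
        √(γ / (pullCount R.A b t ω : ℝ))) ≤
      ENNReal.ofReal (Real.exp 1 * √(2 * Real.pi)) *
        ENNReal.ofReal (Real.exp (3 * armSum R.A R.ξ b t ω ^ 2 / (8 * pullCount R.A b t ω) -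
          D ^ 2 / (32 * γ) * pullCount R.A b t ω)) := by
  have hn' : (0 : ℝ) < pullCount R.A b t ω := by exact_mod_cast hn
  rw [R.sampleMean_eq b hn]
  set n : ℝ := (pullCount R.A b t ω : ℝ)
  set S : ℝ := armSum R.A R.ξ b t ω
  have hsγ : 0 < √γ := Real.sqrt_pos.2 hγ
  have hsn : 0 < √n := Real.sqrt_pos.2 hn'
  have hγ2 : √γ ^ 2 = γ := Real.sq_sqrt hγ.le
  have hn2 : √n ^ 2 = n := Real.sq_sqrt hn'.le
  have hs : σ b / √γ ≤ 1 / 2 := by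
    rw [div_le_iff₀ hsγ]
    have : (2 * σ b) ^ 2 ≤ √γ ^ 2 := by rw [hγ2]; linarith
    linarith [(abs_le_of_sq_le_sq' this hsγ.le).2]
  have h1 : (μ b - D / 2 - (μ b + σ b * S / n)) / √(γ / n) =
      -(D / 2 * √n / √γ) + σ b / √γ * (-S / √n) := by
    rw [Real.sqrt_div hγ.le]
    nth_rw 1 [← hn2]
    field_simp
    ring
  have h2 : 3 * (-S / √n) ^ 2 / 8 - (D / 2 * √n / √γ) ^ 2 / 8 =
      3 * S ^ 2 / (8 * n) - D ^ 2 / (32 * γ) * n := by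
    simp only [div_pow, mul_pow, hγ2, hn2, neg_sq]
    field_simp
    ring
  rw [h1, ← ENNReal.ofReal_mul (by positivity), ← h2]
  exact gaussianOdds_le (by positivity) (by positivity) hs

/-- Overestimation by `D/4` gives `γS² ≥ 4σ²S² ≥ D²n²/4`, so the exponent is nonnegative. The
indicator of this event is thus bounded by the same functional as the odds. -/
lemma one_le_exp_of_lt_noiseSum (hγ : 0 < γ) {a : Fin K} (hσγ : 4 * σ a ^ 2 ≤ γ)
    {D S n : ℝ} (hD : 0 < D) (hn : 0 < n) (h : D / 4 < σ a * S / n) :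
    1 ≤ ENNReal.ofReal (Real.exp (3 * S ^ 2 / (8 * n) - D ^ 2 / (32 * γ) * n)) := by
  rw [ENNReal.one_le_ofReal, Real.one_le_exp_iff, sub_nonneg]
  rw [lt_div_iff₀ hn] at h
  have h1 : (D / 4 * n) ^ 2 ≤ (σ a * S) ^ 2 := pow_le_pow_left₀ (by positivity) h.le 2
  have h2 : 4 * (σ a * S) ^ 2 ≤ γ * S ^ 2 := by
    rw [mul_pow]
    nlinarith [sq_nonneg S]
  rw [div_mul_eq_mul_div, div_le_div_iff₀ (by positivity) (by positivity)]
  nlinarith [sq_nonneg (D * n), mul_nonneg hγ.le (sq_nonneg S)]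

/-- After `l` pulls the posterior deviation is at most `√(γ/l)`; an excess of `D/4` over the
empirical mean must therefore come from a large `Z`. -/
lemma lt_Z_of_lt_sample (hγ : 0 < γ) {a : Fin K} {D : ℝ} (hD : 0 < D) {l t : ℕ}
    (hl : 1 ≤ l) {ω : Ω} (hn : l ≤ pullCount R.A a t ω)
    (hmean : sampleMean R.A R.X a t ω ≤ μ a + D / 4) (hs : μ a + D / 2 < R.sample a t ω) :
    D / 4 * √(l / γ) < R.Z a t ω := by
  have hl' : (0 : ℝ) < l := by exact_mod_cast hl
  have hn' : (l : ℝ) ≤ pullCount R.A a t ω := by exact_mod_cast hn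
  rw [sample] at hs
  set n : ℝ := (pullCount R.A a t ω : ℝ)
  have hn0 : 0 < n := hl'.trans_le hn'
  have h1 : D / 4 < √(γ / n) * R.Z a t ω := by linarith
  have hq : 0 < √(γ / n) := Real.sqrt_pos.2 (by positivity)
  have hZ : 0 < R.Z a t ω := by
    by_contra hneg
    nlinarith [mul_nonneg hq.le (sub_nonneg.2 (not_lt.1 hneg))]
  have h2 : √(l / γ) * √(γ / n) ≤ 1 := by
    rw [← Real.sqrt_mul (by positivity), div_mul_div_comm,
      mul_comm γ n]
    exact Real.sqrt_le_one.2 ((div_le_one (by positivity)).2 (by gcongr))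
  have hr : 0 < √(l / γ) := Real.sqrt_pos.2 (by positivity)
  calc D / 4 * √(l / γ) < √(γ / n) * R.Z a t ω * √(l / γ) := by gcongr
    _ = (√(l / γ) * √(γ / n)) * R.Z a t ω := by ring
    _ ≤ 1 * R.Z a t ω := by gcongr
    _ = R.Z a t ω := one_mul _

lemma measure_lt_Z_le (a : Fin K) (t : ℕ) {x : ℝ} (hx : 0 ≤ x) :
    P {ω | x < R.Z a t ω} ≤ ENNReal.ofReal (Real.exp (-x ^ 2 / 2)) := by
  have : P {ω | x < R.Z a t ω} = P.map (R.Z a t) (Set.Ioi x) :=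
    (Measure.map_apply (R.measurable_Z a t) measurableSet_Ioi).symm
  rw [this, R.law_Z]
  exact stdGaussian_Ioi_le hx

/-! ### Splitting the pulls of a suboptimal arm. -/

lemma ite_arm_eq_le (hγ : 0 < γ) {j : Fin K} (hσγ : 4 * σ j ^ 2 ≤ γ)
    {D : ℝ} (hD : 0 < D) {l : ℕ} (hl : 1 ≤ l) (t : ℕ) (ω : Ω) :
    (if R.A t ω = j then (1 : ℝ≥0∞) else 0) ≤
      (if R.A t ω = j ∧ pullCount R.A j t ω < l then 1 else 0) +
      ({ω | D / 4 * √(l / γ) < R.Z j t ω}.indicator 1 ω +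
      ((if R.A t ω = j ∧ 1 ≤ pullCount R.A j t ω then
        ENNReal.ofReal (Real.exp (3 * armSum R.A R.ξ j t ω ^ 2 / (8 * pullCount R.A j t ω) -
          D ^ 2 / (32 * γ) * pullCount R.A j t ω)) else 0) +
      if K ≤ t then if R.A t ω = j ∧ R.sample j t ω ≤ μ j + D / 2 then 1 else 0 else 0)) := by
  by_cases hA : R.A t ω = j
  swap
  · simp [hA]
  by_cases h1 : pullCount R.A j t ω < l
  · simp [hA, h1]
  have hn : l ≤ pullCount R.A j t ω := not_lt.1 h1
  have hn1 : 1 ≤ pullCount R.A j t ω := hl.trans hn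
  have ht : K ≤ t := by
    by_contra h
    have := R.pullCount_eq_zero (not_le.1 h) hA
    omega
  simp only [hA, h1, hn1, ht, and_self, if_true, and_false, if_false, zero_add, true_and]
  by_cases h2 : R.sample j t ω ≤ μ j + D / 2
  · rw [if_pos h2]
    exact le_add_self.trans le_add_self
  by_cases h3 : sampleMean R.A R.X j t ω ≤ μ j + D / 4
  · have : ω ∈ {ω | D / 4 * √(l / γ) < R.Z j t ω} :=
      R.lt_Z_of_lt_sample hγ hD hl hn h3 (not_le.1 h2)
    rw [Set.indicator_of_mem this, Pi.one_apply]
    exact le_self_add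
  · rw [R.sampleMean_eq j hn1] at h3
    refine le_trans ?_ (le_self_add.trans le_add_self)
    exact one_le_exp_of_lt_noiseSum hγ hσγ hD (by exact_mod_cast hn1) (by linarith)

lemma lintegral_pullCount_eq (j : Fin K) (T : ℕ) :
    ∫⁻ ω, (pullCount R.A j T ω : ℝ≥0∞) ∂P =
      ∑ t ∈ Finset.range T, ∫⁻ ω, (if R.A t ω = j then 1 else 0) ∂P := by
  rw [← lintegral_finsetSum _ fun t _ =>
    Measurable.ite (measurableSet_arm_eq (R.measurable_A t) j) measurable_const measurable_const]
  refine lintegral_congr fun ω => ?_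
  rw [pullCount, Finset.card_filter]
  push_cast
  rfl

lemma lintegral_pullCount_le [IsProbabilityMeasure P] (hγ : 0 < γ) (hσ : ∀ a, 0 < σ a)
    (hσγ : ∀ a, 4 * σ a ^ 2 ≤ γ) {b j : Fin K} {D : ℝ} (hD : 0 < D) (hbj : μ b - μ j = D)
    {l : ℕ} (hl : 1 ≤ l) (T : ℕ) :
    ∫⁻ ω, (pullCount R.A j T ω : ℝ≥0∞) ∂P ≤
      l + (T * ENNReal.ofReal (Real.exp (-(D ^ 2 * l / (32 * γ)))) +
      (ENNReal.ofReal (64 * (γ / D ^ 2)) + ENNReal.ofReal (Real.exp 1 * √(2 * Real.pi)) *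
        ENNReal.ofReal (64 * (γ / D ^ 2)))) := by
  have hc : 0 < D ^ 2 / (32 * γ) := by positivity
  have hc' : 2 / (D ^ 2 / (32 * γ)) = 64 * (γ / D ^ 2) := by
    field_simp
    ring
  have hm₁ : ∀ t, Measurable fun ω =>
      if R.A t ω = j ∧ pullCount R.A j t ω < l then (1 : ℝ≥0∞) else 0 := fun t =>
    R.measurable_ite_count measurable_const j t (q := fun b n => b = j ∧ n < l)
  have hm₂ : ∀ t, MeasurableSet {ω | D / 4 * √(l / γ) < R.Z j t ω} := fun t =>
    R.measurable_Z j t measurableSet_Ioi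
  have hm₃ : ∀ t a, Measurable fun ω => if R.A t ω = a ∧ 1 ≤ pullCount R.A a t ω then
      ENNReal.ofReal (Real.exp (3 * armSum R.A R.ξ a t ω ^ 2 / (8 * pullCount R.A a t ω) -
        D ^ 2 / (32 * γ) * pullCount R.A a t ω)) else 0 := fun t a => by
    have h1 := R.measurable_noiseSum a t
    have h2 : Measurable fun ω => (pullCount R.A a t ω : ℝ) :=
      measurable_from_nat.comp (R.measurable_count a t)
    exact R.measurable_ite_count (by fun_prop) a t (q := fun b n => b = a ∧ 1 ≤ n)
  rw [R.lintegral_pullCount_eq]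
  refine (Finset.sum_le_sum fun t _ =>
    lintegral_mono (R.ite_arm_eq_le hγ (hσγ j) hD hl t)).trans ?_
  simp_rw [lintegral_add_left (hm₁ _), lintegral_add_left (measurable_one.indicator (hm₂ _)),
    lintegral_add_left (hm₃ _ j), Finset.sum_add_distrib]
  refine add_le_add ?_ (add_le_add ?_ (add_le_add ?_ ?_))
  · rw [← lintegral_finsetSum _ fun t _ => hm₁ t]
    calc _ ≤ ∫⁻ _, (l : ℝ≥0∞) ∂P := by
          refine lintegral_mono fun ω => ?_
          have h := card_pulls_of_pullCount_lt (A := R.A) j l T ω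
          have h' : (∑ s ∈ Finset.range T,
              if R.A s ω = j ∧ pullCount R.A j s ω < l then (1 : ℝ≥0∞) else 0) =
              ((min (pullCount R.A j T ω) l : ℕ) : ℝ≥0∞) := by
            rw [← h]
            push_cast
            rfl
          rw [h']
          exact Nat.cast_le.2 (min_le_right _ _)
      _ = l := by simp
  · calc _ ≤ ∑ _t ∈ Finset.range T, ENNReal.ofReal (Real.exp (-(D ^ 2 * l / (32 * γ)))) := by
          refine Finset.sum_le_sum fun t _ => ?_
          rw [lintegral_indicator_one (hm₂ t)]
          refine (R.measure_lt_Z_le j t (by positivity)).trans (le_of_eq ?_)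
          rw [mul_pow, Real.sq_sqrt (by positivity)]
          congr 2
          field_simp
          ring
      _ = _ := by simp
  · rw [← hc']
    exact R.sum_lintegral_exp_sq_sub_le j hc T
  · rw [← hc']
    refine le_trans ?_ (mul_le_mul_right (R.sum_lintegral_exp_sq_sub_le b hc T) _)
    rw [Finset.mul_sum]
    refine Finset.sum_le_sum fun t _ => ?_
    rw [← lintegral_const_mul _ (hm₃ t b)]
    by_cases ht : K ≤ t
    · simp only [ht, if_true]
      refine (R.measure_arm_sample_le hγ (b := b) ht _).trans (lintegral_mono fun ω => ?_)
      have hn := R.one_le_pullCount b ht ω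
      by_cases hA : R.A t ω = b
      · simp only [hA, hn, and_self, if_true]
        rw [show μ j + D / 2 = μ b - D / 2 by linarith]
        exact R.gaussianOdds_threshold_le hγ (hσ b) (hσγ b) hD hn
      · simp [hA]
    · simp [ht]

lemma integrable_pullCount [IsProbabilityMeasure P] (j : Fin K) (T : ℕ) :
    Integrable (fun ω => (pullCount R.A j T ω : ℝ)) P := by
  refine Integrable.of_bound
    (measurable_from_nat.comp (R.measurable_count j T) :
      Measurable fun ω => (pullCount R.A j T ω : ℝ)).aestronglyMeasurable T
    (ae_of_all _ fun ω => ?_)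
  rw [Real.norm_natCast]
  exact_mod_cast pullCount_le j T ω

lemma integral_pullCount_le [IsProbabilityMeasure P] (hγ : 0 < γ) (hσ : ∀ a, 0 < σ a)
    (hσγ : ∀ a, 4 * σ a ^ 2 ≤ γ) {b j : Fin K} {D : ℝ} (hD : 0 < D) (hbj : μ b - μ j = D)
    {l : ℕ} (hl : 1 ≤ l) (T : ℕ) :
    ∫ ω, (pullCount R.A j T ω : ℝ) ∂P ≤ l + T * Real.exp (-(D ^ 2 * l / (32 * γ))) +
      64 * (1 + Real.exp 1 * √(2 * Real.pi)) * (γ / D ^ 2) := by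
  rw [integral_eq_lintegral_of_nonneg_ae (ae_of_all _ fun ω => Nat.cast_nonneg _)
    (R.integrable_pullCount j T).aestronglyMeasurable]
  refine ENNReal.toReal_le_of_le_ofReal (by positivity) ?_
  simp_rw [ENNReal.ofReal_natCast]
  refine (R.lintegral_pullCount_le hγ hσ hσγ hD hbj hl T).trans (le_of_eq ?_)
  rw [← ENNReal.ofReal_mul (by positivity), ← ENNReal.ofReal_add (by positivity) (by positivity),
    ← ENNReal.ofReal_natCast T, ← ENNReal.ofReal_mul (by positivity),
    ← ENNReal.ofReal_add (by positivity) (by positivity), ← ENNReal.ofReal_natCast l,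
    ← ENNReal.ofReal_add (by positivity) (by positivity)]
  congr 1
  ring

end StableTSRun

/-! ### Choice of the exploration level. -/

/-- This makes `(γ/D²) log(TD²/γ + e)` at least 1, so that rounding `l` up can be absorbed. If `D²/γ
≤ 1`, the summand `e` suffices; otherwise the logarithm is at least `log T`. -/
lemma le_log_of_sq_le {D γ : ℝ} (hγ : 0 < γ) {T : ℕ} (hT : 1 ≤ T)
    (h : D ^ 2 ≤ γ * Real.log T) :
    D ^ 2 / γ ≤ Real.log (T * D ^ 2 / γ + Real.exp 1) := by
  have hT' : (1 : ℝ) ≤ T := by exact_mod_cast hT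
  have hx0 : 0 ≤ D ^ 2 / γ := by positivity
  have hx : D ^ 2 / γ ≤ Real.log T := by rwa [div_le_iff₀' hγ]
  rw [mul_div_assoc]
  rcases le_total (D ^ 2 / γ) 1 with h1 | h1
  · refine h1.trans ?_
    rw [Real.le_log_iff_exp_le (by positivity)]
    linarith [mul_nonneg (zero_le_one.trans hT') hx0]
  · refine hx.trans (Real.log_le_log (by linarith) ?_)
    nlinarith [Real.exp_pos 1]

lemma gap_nonneg {K : ℕ} (μ : Fin K → ℝ) (a : Fin K) : 0 ≤ gap μ a :=
  sub_nonneg.2 (le_ciSup (Set.finite_range μ).bddAbove a)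

namespace StableTSRun

variable {K : ℕ} {Ω : Type*} [mΩ : MeasurableSpace Ω] {P : Measure Ω} {μ σ : Fin K → ℝ} {γ : ℝ}
  (R : StableTSRun P μ σ γ)

lemma integral_pullCount_le_log [IsProbabilityMeasure P] (hγ : 0 < γ) (hσ : ∀ a, 0 < σ a)
    (hσγ : ∀ a, 4 * σ a ^ 2 ≤ γ) {j : Fin K} (hj : 0 < gap μ j) {T : ℕ} (hT : 1 ≤ T)
    (hgap : gap μ j ^ 2 ≤ γ * Real.log T) :
    ∫ ω, (pullCount R.A j T ω : ℝ) ∂P ≤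
      33 * (γ / gap μ j ^ 2) * Real.log (T * gap μ j ^ 2 / γ + Real.exp 1) +
        (65 + 64 * (Real.exp 1 * √(2 * Real.pi))) * (γ / gap μ j ^ 2) := by
  have : Nonempty (Fin K) := ⟨j⟩
  obtain ⟨b, hb⟩ := exists_eq_ciSup_of_finite (f := μ)
  have hbj : μ b - μ j = gap μ j := by rw [gap, hb]
  have hlog := le_log_of_sq_le hγ hT hgap
  set D := gap μ j
  set V : ℝ := T * D ^ 2 / γ + Real.exp 1 with hV
  have hV0 : 0 < V := by positivity
  have hx : 0 < D ^ 2 / γ := by positivity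
  have hlog0 : 0 < Real.log V := hx.trans_le hlog
  -- With this level `exp(-D²L/(32γ)) = 1/V`, and `T/V ≤ γ/D²`.
  set L : ℝ := 32 * (γ / D ^ 2) * Real.log V with hL
  have hL0 : 0 < L := by positivity
  refine (R.integral_pullCount_le hγ hσ hσγ hj hbj (l := ⌈L⌉₊) (Nat.ceil_pos.2 hL0) T).trans ?_
  have h1 : (⌈L⌉₊ : ℝ) ≤ L + 1 := (Nat.ceil_lt_add_one hL0.le).le
  -- Pays for the ceiling and turns the factor 32 into 33.
  have h2 : (1 : ℝ) ≤ γ / D ^ 2 * Real.log V := by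
    calc (1 : ℝ) = γ / D ^ 2 * (D ^ 2 / γ) := by field_simp
      _ ≤ _ := by gcongr
  have h3 : T * Real.exp (-(D ^ 2 * ⌈L⌉₊ / (32 * γ))) ≤ γ / D ^ 2 := by
    have h4 : Real.log V ≤ D ^ 2 * ⌈L⌉₊ / (32 * γ) := by
      calc Real.log V = D ^ 2 * L / (32 * γ) := by rw [hL]; field_simp
        _ ≤ _ := by
          gcongr
          exact Nat.le_ceil L
    calc T * Real.exp (-(D ^ 2 * ⌈L⌉₊ / (32 * γ))) ≤ T * Real.exp (-Real.log V) := by gcongr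
      _ = T / V := by rw [Real.exp_neg, Real.exp_log hV0, div_eq_mul_inv]
      _ ≤ γ / D ^ 2 := by
        rw [div_le_div_iff₀ hV0 (by positivity)]
        have : γ * V = T * D ^ 2 + γ * Real.exp 1 := by rw [hV]; field_simp
        rw [this]
        linarith [mul_pos hγ (Real.exp_pos 1)]
  calc _ ≤ (L + 1) + γ / D ^ 2 + 64 * (1 + Real.exp 1 * √(2 * Real.pi)) * (γ / D ^ 2) := by
        gcongr
    _ ≤ (L + γ / D ^ 2 * Real.log V) + γ / D ^ 2 +
          64 * (1 + Real.exp 1 * √(2 * Real.pi)) * (γ / D ^ 2) := by gcongr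
    _ = _ := by
        rw [hL]
        ring

/-! ### Expected rewards and regret. -/

lemma integrable_ξ (t : ℕ) : Integrable (R.ξ t) P := by
  have h : Integrable id (P.map (R.ξ t)) := by
    rw [R.law_ξ]
    exact (memLp_id_gaussianReal 1).integrable (by simp)
  exact h.comp_measurable (R.measurable_ξ t)

lemma integral_ξ (t : ℕ) : ∫ ω, R.ξ t ω ∂P = 0 := by
  rw [← integral_map (f := fun x => x) (R.measurable_ξ t).aemeasurable
    measurable_id.aestronglyMeasurable, R.law_ξ, integral_id_gaussianReal]

lemma integrable_comp_arm [IsProbabilityMeasure P] (f : Fin K → ℝ) (t : ℕ) :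
    Integrable (fun ω => f (R.A t ω)) P := by
  have hm : Measurable fun ω => f (R.A t ω) := (measurable_of_finite f).comp (R.measurable_A t)
  refine Integrable.of_bound hm.aestronglyMeasurable (∑ a, ‖f a‖) (ae_of_all _ fun ω => ?_)
  exact Finset.single_le_sum (f := fun a => ‖f a‖) (fun _ _ => norm_nonneg _)
    (Finset.mem_univ (R.A t ω))

/-- The arm is fixed before the reward noise is drawn; hence the noise term of the reward has mean
zero even though its scale depends on the arm. -/
lemma indepFun_arm_ξ (f : Fin K → ℝ) (t : ℕ) : IndepFun (fun ω => f (R.A t ω)) (R.ξ t) P := by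
  have h : Measurable[R.info (beforeReward K t)] (f ∘ R.A t) :=
    (measurable_of_finite f).comp ((R.measurable_history_beforeReward t).1 t le_rfl)
  exact indep_of_indep_of_le_left (R.indep_beforeReward t) h.comap_le

lemma integrable_reward [IsProbabilityMeasure P] (t : ℕ) : Integrable (R.X t) P := by
  rw [funext fun ω => R.reward t ω]
  exact (R.integrable_comp_arm μ t).add
    ((R.indepFun_arm_ξ σ t).integrable_mul (R.integrable_comp_arm σ t) (R.integrable_ξ t))

lemma integral_reward [IsProbabilityMeasure P] (t : ℕ) :
    ∫ ω, R.X t ω ∂P = ∫ ω, μ (R.A t ω) ∂P := by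
  have h : Integrable (fun ω => σ (R.A t ω) * R.ξ t ω) P :=
    (R.indepFun_arm_ξ σ t).integrable_mul (R.integrable_comp_arm σ t) (R.integrable_ξ t)
  simp_rw [R.reward t]
  rw [integral_add (R.integrable_comp_arm μ t) h,
    (R.indepFun_arm_ξ σ t).integral_fun_mul_eq_mul_integral
      (R.integrable_comp_arm σ t).aestronglyMeasurable (R.integrable_ξ t).aestronglyMeasurable,
    R.integral_ξ, mul_zero, add_zero]

/-- The regret decomposition. -/
lemma regret_eq [IsProbabilityMeasure P] (T : ℕ) :
    regret P μ R.X T = ∑ a, gap μ a * ∫ ω, (pullCount R.A a T ω : ℝ) ∂P := by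
  have h1 : ∀ ω, ∑ a, gap μ a * (pullCount R.A a T ω : ℝ) =
      ∑ t ∈ Finset.range T, gap μ (R.A t ω) := fun ω => by
    simp_rw [pullCount, Finset.card_filter, Nat.cast_sum, Finset.mul_sum]
    rw [Finset.sum_comm]
    refine Finset.sum_congr rfl fun t _ => ?_
    simp
  have h2 : ∑ a, gap μ a * ∫ ω, (pullCount R.A a T ω : ℝ) ∂P =
      ∑ t ∈ Finset.range T, ∫ ω, gap μ (R.A t ω) ∂P := by
    simp_rw [← integral_const_mul]
    rw [← integral_finsetSum _ fun a _ => (R.integrable_pullCount a T).const_mul _,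
      ← integral_finsetSum _ fun t _ => R.integrable_comp_arm (gap μ) t]
    exact integral_congr_ae (ae_of_all _ h1)
  rw [h2, regret, integral_finsetSum _ fun t _ => R.integrable_reward t]
  simp_rw [R.integral_reward, gap]
  have h3 : ∀ t, ∫ ω, ((⨆ b, μ b) - μ (R.A t ω)) ∂P = (⨆ b, μ b) - ∫ ω, μ (R.A t ω) ∂P :=
    fun t => by
      rw [integral_sub (integrable_const _) (R.integrable_comp_arm μ t)]
      simp
  simp_rw [h3]
  rw [Finset.sum_sub_distrib]
  simp

lemma runBounds [IsProbabilityMeasure P] (hσ : ∀ a, 0 < σ a) (hσγ : ∀ a, 4 * σ a ^ 2 ≤ γ)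
    {T : ℕ} (hT : K ≤ T) (hgap : ∀ a, gap μ a ^ 2 ≤ γ * Real.log T) :
    RunBounds 33 (Real.exp 1) (65 + 64 * (Real.exp 1 * √(2 * Real.pi))) R T := by
  -- A run supplies an arm, which gives `K ≥ 1` and then `γ > 0`.
  have a₀ : Fin K := R.argmax 0
  have hγ : 0 < γ := lt_of_lt_of_le (by have := hσ a₀; positivity) (hσγ a₀)
  have hT1 : 1 ≤ T := (Nat.one_le_iff_ne_zero.2 (Fin.pos a₀).ne').trans hT
  have harm := fun j (hj : 0 < gap μ j) =>
    R.integral_pullCount_le_log hγ hσ hσγ hj hT1 (hgap j)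
  refine ⟨integrable_finsetSum _ fun t _ => R.integrable_reward t, harm, ?_⟩
  rw [R.regret_eq, ← Finset.sum_filter_of_ne (p := fun j => 0 < gap μ j) fun a _ h =>
    lt_of_le_of_ne (gap_nonneg μ a) fun h0 => h (by rw [← h0, zero_mul])]
  refine Finset.sum_le_sum fun j hj => ?_
  have hj' : 0 < gap μ j := (Finset.mem_filter.1 hj).2
  refine (mul_le_mul_of_nonneg_left (harm j hj') hj'.le).trans (le_of_eq ?_)
  field_simp

end StableTSRun

theorem proposition1 :
    ∃ κ₁ κ₂ κ₃ : ℝ, 0 < κ₁ ∧ 0 < κ₂ ∧ 0 < κ₃ ∧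
      ∀ (K : ℕ) (μ σ : Fin K → ℝ), (∀ a, 0 < σ a) →
        -- explicit finite-horizon form
        (∀ (T : ℕ) (γ : ℝ), K ≤ T → (∀ a, 4 * σ a ^ 2 ≤ γ) →
          (∀ a, gap μ a ^ 2 ≤ γ * Real.log T) →
          ∀ (Ω : Type u) [MeasurableSpace Ω] (P : Measure Ω) [IsProbabilityMeasure P]
            (R : StableTSRun P μ σ γ), RunBounds κ₁ κ₂ κ₃ R T) ∧
        -- form for a tuning sequence, for all large horizons
        (∀ γ : ℕ → ℝ,
          Tendsto (fun T : ℕ => γ T / Real.log (Real.log T)) atTop atTop →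
          Tendsto (fun T : ℕ => √(Real.log T) / γ T) atTop atTop →
          ∀ᶠ T : ℕ in atTop,
            ∀ (Ω : Type u) [MeasurableSpace Ω] (P : Measure Ω) [IsProbabilityMeasure P]
              (R : StableTSRun P μ σ (γ T)), RunBounds κ₁ κ₂ κ₃ R T) := by
  refine ⟨33, Real.exp 1, 65 + 64 * (Real.exp 1 * √(2 * Real.pi)), by norm_num, Real.exp_pos 1,
    by positivity, fun K μ σ hσ => ⟨fun T γ hT hσγ hgap Ω _ P _ R => R.runBounds hσ hσγ hT hgap,
      fun γ hγ _ => ?_⟩⟩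
  have hlog : Tendsto (fun T : ℕ => Real.log T) atTop atTop :=
    Real.tendsto_log_atTop.comp tendsto_natCast_atTop_atTop
  have hloglog := Real.tendsto_log_atTop.comp hlog
  -- Eventually `γ T ≥ log (log T)`. For a fixed bandit the finitely many conditions of the
  -- finite-horizon form then hold for all large `T`.
  have hγ' : Tendsto γ atTop atTop := by
    refine tendsto_atTop_mono' _ ?_ hloglog
    filter_upwards [hγ.eventually_ge_atTop 1, hloglog.eventually_gt_atTop 0] with T h1 h2
    exact (one_le_div h2).1 h1
  have hprod := hγ'.atTop_mul_atTop₀ hlog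
  filter_upwards [eventually_ge_atTop K,
    eventually_all.2 fun a => hγ'.eventually_ge_atTop (4 * σ a ^ 2),
    eventually_all.2 fun a => hprod.eventually_ge_atTop (gap μ a ^ 2)] with T h1 h2 h3 Ω _ P _ R
  exact R.runBounds hσ h2 h1 h3
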